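/- Let $k$ be a field, $X$ a set, $\Gamma$ a group and, for each $x\in X$, let $\Gamma(x),\Gamma'(x)\le\Gamma$ be subgroups with a fixed isomorphism $\Gamma(x)\to\Gamma'(x)$, $\gamma\mapsto\gamma'$. The free $\Gamma$-algebra $k\langle X;\Gamma\rangle$ is the associative unital $k$-algebra generated by $X\cup\Gamma$ with defining relations $\gamma x=x\gamma'$ ($x\in X$, $\gamma\in\Gamma(x)$) together with the multiplication table of $\Gamma$ (with $1_\Gamma=1$). It has a linear basis consisting of the $\Gamma$-words $u=\gamma_0x_{1}\gamma_1\cdots x_{n}\gamma_n$ ($n\ge 0$, $x_i\in X$, $\gamma_i\in\Gamma$), taken up to the equivalence generated by $\gamma x=x\gamma'$; put $[u]=x_1\cdots x_n\in X^*$ and $\deg u=n$. Fix a monomial order on $X^*$ (a well order $<$ such that $p<q$ implies $cpd<cqd$ for all $c,d\in X^*$), and quasi-order the $\Gamma$-words by $u\le v\Leftrightarrow[u]\le[v]$, so that $u<v$ means $[u]<[v]$. A leading monomial of $f\in k\langle X;\Gamma\rangle$ is a $\Gamma$-word $u$ occurring in $f$ with nonzero coefficient such that no $\Gamma$-word $v$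 occurring in $f$ satisfies $v>u$. The element $f$ is strong if it has exactly one leading monomial, which is then denoted $\bar f$. For strong $f,g$, normalized so that $\bar f$ and $\bar g$ have coefficient $1$, and $\Gamma$-words $a,b$, the compositions $(f,g)_w$ are: the inclusion composition $f-agb$, if $w=\bar f=a\bar g b$; the intersection composition $fb-ag$, if $w=\bar f b=a\bar g$ and $\deg w<\deg\bar f+\deg\bar g$. (The case $f=g$ is allowed, in particular with $a,b\in\Gamma$.) A set $S$ of strong elements is a strong $\Gamma$-Gröbner–Shirshov basis if every composition $(f,g)_w$ with $f,g\in S$ is trivial modulo $(S,w)$, that is, $(f,g)_w=\sum_i\alpha_ia_is_ib_i$ (a finite sum) with $\alpha_i\in k$, $s_i\in S$, $a_i,b_i$ $\Gamma$-words and $a_i\bar s_ib_i<w$. **Theorem.** Let $S\subset k\langle X;\Gamma\rangle$ be a strong $\Gamma$-Gröbner–Shirshov basis. Then: (a) If $0\ne f\in \mathrm{Id}(S)$, the two-sided ideal generated by $S$, then $f$ has a leading monomial, and every leading monomial of $f$ is of the form $a\bar s b$ with $s\in S$ and $a,b$ $\Gamma$-words. (b) The (images of the) $\Gamma$-words in $\mathrm{Irr}(S)=\{u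 : u\ne a\bar s b \text{ for all } s\in S \text{ and all } \Gamma\text{-words } a,b\}$ form a linear basis of $k\langle X;\Gamma|S\rangle=k\langle X;\Gamma\rangle/\mathrm{Id}(S)$ (distinct elements of $\mathrm{Irr}(S)$ having distinct images). -/

import Mathlib

noncomputable section

namespace FreeGamma

section Words

variable {X Γ : Type*} [Group Γ] {P Q : X → Subgroup Γ}

/-- The defining relations, on the alphabet `Γ ∪ X`: `γ x = x γ'` for `x ∈ X` and `γ ∈ Γ(x)`, where
`γ' = φ x γ` is the image of `γ` under the isomorphism `φ x : Γ(x) ≃ Γ'(x)`, together with the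
multiplication table of `Γ` (the unit of `Γ` being the empty word). -/
inductive Rel (φ : ∀ x, P x ≃* Q x) : FreeMonoid (Γ ⊕ X) → FreeMonoid (Γ ⊕ X) → Prop
  | slide (x : X) (γ : P x) :
      Rel φ (FreeMonoid.of (Sum.inl (γ : Γ)) * FreeMonoid.of (Sum.inr x))
        (FreeMonoid.of (Sum.inr x) * FreeMonoid.of (Sum.inl (φ x γ : Γ)))
  | mul (γ δ : Γ) :
      Rel φ (FreeMonoid.of (Sum.inl γ) * FreeMonoid.of (Sum.inl δ))
        (FreeMonoid.of (Sum.inl (γ * δ)))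
  | one : Rel φ (FreeMonoid.of (Sum.inl 1)) 1

/-- The monoid of `Γ`-words: words `γ₀ x₁ γ₁ ⋯ xₙ γₙ`, up to the equivalence generated by
`γ x = x γ'`. -/
abbrev Word (φ : ∀ x, P x ≃* Q x) : Type _ := PresentedMonoid (Rel φ)

/-- The projection `γ₀ x₁ γ₁ ⋯ xₙ γₙ ↦ x₁ ⋯ xₙ`. -/
def proj (φ : ∀ x, P x ≃* Q x) : Word φ →* FreeMonoid X :=
  PresentedMonoid.lift (Sum.elim (fun _ => 1) FreeMonoid.of) (by
    intro a b h
    cases h <;> simp)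

/-- The degree of a `Γ`-word: the number of its letters from `X`. -/
def deg (φ : ∀ x, P x ≃* Q x) (u : Word φ) : ℕ := (proj φ u).length

/-- `r` is (the strict part of) a monomial order on `X*`: a well order compatible with
multiplication on both sides. -/
structure IsMonomialOrder (r : FreeMonoid X → FreeMonoid X → Prop) : Prop where
  isWellOrder : IsWellOrder (FreeMonoid X) r
  mul_lt_mul : ∀ u v a b : FreeMonoid X, r u v → r (a * u * b) (a * v * b)

end Words

section Alg

variable (k : Type*) [Field k] {X Γ : Type*} [Group Γ] {P Q : X → Subgroup Γ}

/-- The free `Γ`-algebra `k⟨X;Γ⟩`: the algebra with the defining relations `Rel φ`, that is, the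
monoid algebra of the monoid of `Γ`-words; see `algEquivPresented`. -/
abbrev Alg (φ : ∀ x, P x ≃* Q x) : Type _ := MonoidAlgebra k (Word φ)

/-- The defining relations, read in the free associative algebra `k⟨X ∪ Γ⟩`. -/
inductive AlgRel (φ : ∀ x, P x ≃* Q x) :
    FreeAlgebra k (Γ ⊕ X) → FreeAlgebra k (Γ ⊕ X) → Prop
  | slide (x : X) (γ : P x) :
      AlgRel φ (FreeAlgebra.ι k (Sum.inl (γ : Γ)) * FreeAlgebra.ι k (Sum.inr x))
        (FreeAlgebra.ι k (Sum.inr x) * FreeAlgebra.ι k (Sum.inl (φ x γ : Γ)))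
  | mul (γ δ : Γ) :
      AlgRel φ (FreeAlgebra.ι k (Sum.inl γ) * FreeAlgebra.ι k (Sum.inl δ))
        (FreeAlgebra.ι k (Sum.inl (γ * δ)))
  | one : AlgRel φ (FreeAlgebra.ι k (Sum.inl 1)) 1

/-- `k⟨X;Γ⟩` is the associative unital algebra presented by the generators `X ∪ Γ` and the
defining relations. -/
def algEquivPresented (φ : ∀ x, P x ≃* Q x) : Alg k φ ≃ₐ[k] RingQuot (AlgRel k φ) :=
  AlgEquiv.ofAlgHom
    (MonoidAlgebra.lift k _ (Word φ) (PresentedMonoid.lift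
      (fun z => RingQuot.mkAlgHom k (AlgRel k φ) (FreeAlgebra.ι k z)) (by
        intro a b h
        cases h with
        | slide x γ => simpa using RingQuot.mkAlgHom_rel k (AlgRel.slide (φ := φ) x γ)
        | mul γ δ => simpa using RingQuot.mkAlgHom_rel k (AlgRel.mul (φ := φ) γ δ)
        | one => simpa using RingQuot.mkAlgHom_rel k (AlgRel.one (φ := φ)))))
    (RingQuot.liftAlgHom k ⟨FreeAlgebra.lift k
      (fun z => MonoidAlgebra.of k (Word φ) (PresentedMonoid.of (Rel φ) z)), by
        intro a b h
        cases h with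
        | slide x γ =>
          simp only [map_mul, FreeAlgebra.lift_ι_apply]
          rw [← map_mul, ← map_mul]
          exact congrArg _ (PresentedMonoid.mk_eq_mk_of_rel (Rel.slide (φ := φ) x γ))
        | mul γ δ =>
          simp only [map_mul, FreeAlgebra.lift_ι_apply]
          rw [← map_mul]
          exact congrArg _ (PresentedMonoid.mk_eq_mk_of_rel (Rel.mul (φ := φ) γ δ))
        | one =>
          simp only [map_one, FreeAlgebra.lift_ι_apply]
          rw [← map_one (MonoidAlgebra.of k (Word φ))]
          exact congrArg _ (PresentedMonoid.mk_eq_mk_of_rel (Rel.one (φ := φ)))⟩)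
    (by
      apply RingQuot.ringQuot_ext'
      apply FreeAlgebra.hom_ext
      funext z
      simp)
    (by
      apply MonoidAlgebra.algHom_ext'
      · apply PresentedMonoid.ext
        intro z
        simp
      · ext)

end Alg

section Basis

variable {k : Type*} [Field k] {X Γ : Type*} [Group Γ] {P Q : X → Subgroup Γ}
  {φ : ∀ x, P x ≃* Q x}

/-- A `Γ`-word as an element of `k⟨X;Γ⟩`. -/
def mono (k : Type*) [Field k] (u : Word φ) : Alg k φ := MonoidAlgebra.of k (Word φ) u

/-- `u` is a leading monomial of `f` for the quasi-order `u ≤ v ↔ [u] ≤ [v]`: it occurs in `f`, and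
no monomial of `f` is strictly larger. -/
def IsLeading (r : FreeMonoid X → FreeMonoid X → Prop) (f : Alg k φ) (u : Word φ) : Prop :=
  u ∈ f.coeff.support ∧ ∀ v ∈ f.coeff.support, ¬ r (proj φ u) (proj φ v)

/-- `f` is strong: it has exactly one leading monomial. -/
def IsStrong (r : FreeMonoid X → FreeMonoid X → Prop) (f : Alg k φ) : Prop :=
  ∃! u, IsLeading r f u

/-- `f` divided by its coefficient at `u`; for a monic `f` with leading monomial `u` this is `f`. -/
def normalize (f : Alg k φ) (u : Word φ) : Alg k φ := (f.coeff u)⁻¹ • f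

/-- `IsComposition r f g h w`: the element `h` is a composition `(f, g)_w` of the strong
`Γ`-polynomials `f` and `g`, which are first made monic. Here `u = f̄`, `v = ḡ`, and `a`, `b` are
arbitrary `Γ`-words; in particular `f = g` with `a` and `b` in `Γ` is allowed. -/
inductive IsComposition (r : FreeMonoid X → FreeMonoid X → Prop) (f g : Alg k φ) :
    Alg k φ → Word φ → Prop
  | inclusion (u v a b : Word φ) (hu : IsLeading r f u) (hv : IsLeading r g v)
      (hw : u = a * v * b) :
      IsComposition r f g (normalize f u - mono k a * normalize g v * mono k b) u
  | intersection (u v a b : Word φ) (hu : IsLeading r f u) (hv : IsLeading r g v)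
      (hw : u * b = a * v) (hdeg : deg φ (u * b) < deg φ u + deg φ v) :
      IsComposition r f g (normalize f u * mono k b - mono k a * normalize g v) (u * b)

/-- `h` is trivial modulo `(S, w)`: it is a `k`-linear combination of elements `a s b` with `s ∈ S`,
`a`, `b` `Γ`-words and `a s̄ b < w`. -/
def IsTrivialMod (r : FreeMonoid X → FreeMonoid X → Prop) (S : Set (Alg k φ)) (h : Alg k φ)
    (w : Word φ) : Prop :=
  h ∈ Submodule.span k {p : Alg k φ | ∃ s ∈ S, ∃ u a b : Word φ, IsLeading r s u ∧
    r (proj φ (a * u * b)) (proj φ w) ∧ p = mono k a * s * mono k b}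

/-- `S` is a strong `Γ`-Gröbner–Shirshov basis: a set of strong `Γ`-polynomials all of whose
compositions are trivial. -/
structure IsStrongGSBasis (r : FreeMonoid X → FreeMonoid X → Prop) (S : Set (Alg k φ)) : Prop where
  strong : ∀ s ∈ S, IsStrong r s
  trivial : ∀ f ∈ S, ∀ g ∈ S, ∀ h w, IsComposition r f g h w → IsTrivialMod r S h w

/-- `Irr(S)`: the `Γ`-words that are not of the form `a s̄ b` with `s ∈ S` and `a`, `b` `Γ`-words. -/
def Irr (r : FreeMonoid X → FreeMonoid X → Prop) (S : Set (Alg k φ)) : Set (Word φ) :=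
  {u | ∀ s ∈ S, ∀ v a b : Word φ, IsLeading r s v → u ≠ a * v * b}

/-- `Id(S)`, the two-sided ideal generated by `S`. -/
abbrev Id (S : Set (Alg k φ)) : TwoSidedIdeal (Alg k φ) := TwoSidedIdeal.span S

/-- `k⟨X;Γ|S⟩ = k⟨X;Γ⟩ / Id(S)`. -/
abbrev QuotAlg (S : Set (Alg k φ)) : Type _ := (Id S).ringCon.Quotient

end Basis

end FreeGamma

end

/-! The monoid of `Γ`-words is equidivisible: if `p q = p' q'` and `deg p ≤ deg p'`, then `p' = p c`
and `q = c q'` for some `c`. So two occurrences `a s̄ b = a' t̄ b'` in one `Γ`-word are disjoint,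
nested or overlapping, as in a free monoid. For monic `s`, `t`, the elements `a s b` and `a' t b'`
then agree up to smaller terms: by strongness if the occurrences are disjoint, by triviality of
compositions otherwise (`sub_mem_trivialSpan`).

Hence one element `e w = w + (terms of smaller projection)` of the ideal suffices for each reducible
`w`; by well-founded induction these span Id(S) (`exists_reductors`). Although words are only
quasi-ordered, the family is unitriangular: `e w` contains no word of projection `[w]` except `w`.
Therefore a leading monomial of `∑ c_w e w` is one of its indices, hence reducible, which is (a). A
relation among irreducible words would contradict (a), and subtracting `e w` rewrites a reducible
`w` by smaller words, which gives (b). -/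

namespace FreeGamma

/-! ### Equidivisibility of the monoid of `Γ`-words -/

section Words

variable {X Γ : Type*} [Group Γ] {P Q : X → Subgroup Γ} {φ : ∀ x, P x ≃* Q x}

/-- The canonical homomorphism from `Γ` to the monoid of `Γ`-words. -/
def ofGroup (φ : ∀ x, P x ≃* Q x) : Γ →* Word φ where
  toFun γ := PresentedMonoid.of (Rel φ) (Sum.inl γ)
  map_one' := PresentedMonoid.mk_eq_mk_of_rel Rel.one
  map_mul' γ δ := (PresentedMonoid.mk_eq_mk_of_rel (Rel.mul γ δ)).symm

theorem mk_of_inl (γ : Γ) :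
    PresentedMonoid.mk (Rel φ) (FreeMonoid.of (Sum.inl γ)) = ofGroup φ γ := rfl

theorem deg_mul (u v : Word φ) : deg φ (u * v) = deg φ u + deg φ v := by
  simp [deg]

theorem eq_ofGroup_of_deg_eq_zero (u : Word φ) (h : deg φ u = 0) : ∃ γ, u = ofGroup φ γ := by
  obtain ⟨t, rfl⟩ := PresentedMonoid.surjective_mk u
  induction t with
  | one => exact ⟨1, by simp⟩
  | of z =>
    cases z with
    | inl γ => exact ⟨γ, rfl⟩
    | inr x =>
      change (FreeMonoid.of x).length = 0 at h
      simp at h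
  | mul s t hs ht =>
    rw [map_mul, deg_mul, Nat.add_eq_zero_iff] at h
    obtain ⟨γ, hγ⟩ := hs h.1
    obtain ⟨δ, hδ⟩ := ht h.2
    exact ⟨γ * δ, by rw [map_mul, map_mul, hγ, hδ]⟩

theorem freeMonoid_mul_eq_mul {α : Type*} {p q p' q' : FreeMonoid α} (h : p * q = p' * q') :
    (∃ t, p' = p * t ∧ q = t * q') ∨ ∃ t, p = p' * t ∧ q' = t * q :=
  List.append_eq_append_iff.1 h

theorem freeMonoid_mul_eq_of_mul_of {α : Type*} {p q : FreeMonoid α} {a b : α}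
    (h : FreeMonoid.of a * FreeMonoid.of b = p * q) :
    p = 1 ∨ (p = FreeMonoid.of a ∧ q = FreeMonoid.of b) ∨ q = 1 := by
  replace h : p.toList ++ q.toList = [a, b] := h.symm
  rcases List.append_eq_cons_iff.1 h with h | ⟨t, hp, ht⟩
  · exact Or.inl h.1
  rcases List.append_eq_cons_iff.1 ht.symm with h | ⟨s, rfl, hs⟩
  · obtain ⟨rfl, h⟩ := h
    exact Or.inr (Or.inl ⟨hp, h⟩)
  · exact Or.inr (Or.inr (List.append_eq_nil_iff.1 hs.symm).2)

theorem freeMonoid_mul_eq_of {α : Type*} {p q : FreeMonoid α} {a : α}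
    (h : FreeMonoid.of a = p * q) : p = 1 ∨ q = 1 := by
  replace h : p.toList ++ q.toList = [a] := h.symm
  rcases List.append_eq_cons_iff.1 h with h | ⟨t, hp, ht⟩
  · exact Or.inl h.1
  · exact Or.inr (List.append_eq_nil_iff.1 ht.symm).2

/-- Every factorization of the word `w` on the alphabet `Γ ∪ X` can be matched, up to an element
of `Γ` in the middle, with a factorization of `w'`. -/
def SplitsAlong (φ : ∀ x, P x ≃* Q x) (w w' : FreeMonoid (Γ ⊕ X)) : Prop :=
  ∀ p q, w = p * q → ∃ p' q', w' = p' * q' ∧ ∃ γ,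
    PresentedMonoid.mk (Rel φ) p' = PresentedMonoid.mk (Rel φ) p * ofGroup φ γ ∧
    PresentedMonoid.mk (Rel φ) q = ofGroup φ γ * PresentedMonoid.mk (Rel φ) q'

theorem SplitsAlong.of_left_eq_one {w w' p q : FreeMonoid (Γ ⊕ X)}
    (h : PresentedMonoid.mk (Rel φ) w = PresentedMonoid.mk (Rel φ) w') (hw : w = p * q)
    (hp : p = 1) : ∃ p' q', w' = p' * q' ∧ ∃ γ,
      PresentedMonoid.mk (Rel φ) p' = PresentedMonoid.mk (Rel φ) p * ofGroup φ γ ∧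
      PresentedMonoid.mk (Rel φ) q = ofGroup φ γ * PresentedMonoid.mk (Rel φ) q' := by
  subst hp hw
  exact ⟨1, w', by simp, 1, by simp, by simpa using h⟩

theorem SplitsAlong.of_right_eq_one {w w' p q : FreeMonoid (Γ ⊕ X)}
    (h : PresentedMonoid.mk (Rel φ) w = PresentedMonoid.mk (Rel φ) w') (hw : w = p * q)
    (hq : q = 1) : ∃ p' q', w' = p' * q' ∧ ∃ γ,
      PresentedMonoid.mk (Rel φ) p' = PresentedMonoid.mk (Rel φ) p * ofGroup φ γ ∧
      PresentedMonoid.mk (Rel φ) q = ofGroup φ γ * PresentedMonoid.mk (Rel φ) q' := by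
  subst hq hw
  exact ⟨w', 1, by simp, 1, by simpa using h.symm, by simp⟩

theorem SplitsAlong.refl (w : FreeMonoid (Γ ⊕ X)) : SplitsAlong φ w w :=
  fun p q h => ⟨p, q, h, 1, by simp, by simp⟩

theorem SplitsAlong.trans {w₁ w₂ w₃ : FreeMonoid (Γ ⊕ X)} (h₁ : SplitsAlong φ w₁ w₂)
    (h₂ : SplitsAlong φ w₂ w₃) : SplitsAlong φ w₁ w₃ := by
  intro p q h
  obtain ⟨p₂, q₂, h, γ, hp, hq⟩ := h₁ p q h
  obtain ⟨p₃, q₃, h, δ, hp', hq'⟩ := h₂ p₂ q₂ h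
  exact ⟨p₃, q₃, h, γ * δ, by rw [hp', hp, map_mul, mul_assoc],
    by rw [hq, hq', map_mul, mul_assoc]⟩

/-- A cut of a product falls inside one of the two factors; the other factor is carried along
unchanged in the quotient. -/
theorem SplitsAlong.mul {v v' w w' : FreeMonoid (Γ ⊕ X)} (hv : SplitsAlong φ v v')
    (hw : SplitsAlong φ w w')
    (hv' : PresentedMonoid.mk (Rel φ) v = PresentedMonoid.mk (Rel φ) v')
    (hw' : PresentedMonoid.mk (Rel φ) w = PresentedMonoid.mk (Rel φ) w') :
    SplitsAlong φ (v * w) (v' * w') := by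
  intro p q h
  rcases freeMonoid_mul_eq_mul h with ⟨t, rfl, ht⟩ | ⟨t, ht, rfl⟩
  · obtain ⟨p', q', rfl, γ, hp, hq⟩ := hw t q ht
    exact ⟨v' * p', q', by rw [mul_assoc], γ, by rw [map_mul, map_mul, hp, hv', mul_assoc], hq⟩
  · obtain ⟨p', q', rfl, γ, hp, hq⟩ := hv p t ht
    exact ⟨p', q' * w', by rw [mul_assoc], γ, hp, by rw [map_mul, map_mul, hq, hw', mul_assoc]⟩

/-- Only a cut in the middle of a two-letter side needs work: the other side is then cut at one of
its ends, and an element of `Γ` corrects the difference. -/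
theorem SplitsAlong.of_rel {w w' : FreeMonoid (Γ ⊕ X)} (h : Rel φ w w') :
    SplitsAlong φ w w' ∧ SplitsAlong φ w' w := by
  have e := PresentedMonoid.mk_eq_mk_of_rel h
  cases h with
  | slide x γ =>
    constructor <;> intro p q hpq <;>
      rcases freeMonoid_mul_eq_of_mul_of hpq with hp | ⟨rfl, rfl⟩ | hq
    · exact of_left_eq_one e hpq hp
    -- The cut `γ | x` is matched with `1 | x γ'`, since `x = γ⁻¹ (x γ')`.
    · refine ⟨1, _, (one_mul _).symm, (γ : Γ)⁻¹, ?_, ?_⟩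
      · rw [mk_of_inl, ← map_mul, mul_inv_cancel, map_one, map_one]
      · rw [← e, map_mul, mk_of_inl, ← mul_assoc, ← map_mul, inv_mul_cancel, map_one, one_mul]
    · exact of_right_eq_one e hpq hq
    · exact of_left_eq_one e.symm hpq hp
    -- The cut `x | γ'` is matched with `γ x | 1`, since `γ x = x γ'`.
    · refine ⟨_, 1, (mul_one _).symm, (φ x γ : Γ), ?_, ?_⟩
      · rw [e, map_mul, mk_of_inl]
      · rw [mk_of_inl, map_one, mul_one]
    · exact of_right_eq_one e.symm hpq hq
  | mul γ δ =>
    constructor <;> intro p q hpq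
    · rcases freeMonoid_mul_eq_of_mul_of hpq with hp | ⟨rfl, rfl⟩ | hq
      · exact of_left_eq_one e hpq hp
      · refine ⟨_, 1, (mul_one _).symm, δ, ?_, ?_⟩
        · simp only [mk_of_inl, map_mul]
        · rw [mk_of_inl, map_one, mul_one]
      · exact of_right_eq_one e hpq hq
    · rcases freeMonoid_mul_eq_of hpq with hp | hq
      · exact of_left_eq_one e.symm hpq hp
      · exact of_right_eq_one e.symm hpq hq
  | one =>
    constructor <;> intro p q hpq
    · rcases freeMonoid_mul_eq_of hpq with hp | hq
      · exact of_left_eq_one e hpq hp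
      · exact of_right_eq_one e hpq hq
    · exact of_left_eq_one e.symm hpq (List.append_eq_nil_iff.1 hpq.symm).1

/-- Both directions are proved together so that the induction passes through symmetry. -/
theorem SplitsAlong.of_conGen {w w' : FreeMonoid (Γ ⊕ X)} (h : ConGen.Rel (Rel φ) w w') :
    SplitsAlong φ w w' ∧ SplitsAlong φ w' w := by
  induction h with
  | of _ _ h => exact of_rel h
  | refl w => exact ⟨refl w, refl w⟩
  | symm _ ih => exact ih.symm
  | trans _ _ ih₁ ih₂ => exact ⟨ih₁.1.trans ih₂.1, ih₂.2.trans ih₁.2⟩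
  | mul h₁ h₂ ih₁ ih₂ =>
    have e₁ := PresentedMonoid.mk_eq_mk_iff.2 h₁
    have e₂ := PresentedMonoid.mk_eq_mk_iff.2 h₂
    exact ⟨ih₁.1.mul ih₂.1 e₁ e₂, ih₁.2.mul ih₂.2 e₁.symm e₂.symm⟩

/-- The monoid of `Γ`-words is equidivisible. -/
theorem exists_eq_mul_of_mul_eq_mul {p q p' q' : Word φ} (h : p * q = p' * q')
    (hd : deg φ p ≤ deg φ p') : ∃ c, p' = p * c ∧ q = c * q' := by
  obtain ⟨p₀, rfl⟩ := PresentedMonoid.surjective_mk p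
  obtain ⟨q₀, rfl⟩ := PresentedMonoid.surjective_mk q
  obtain ⟨p₁, rfl⟩ := PresentedMonoid.surjective_mk p'
  obtain ⟨q₁, rfl⟩ := PresentedMonoid.surjective_mk q'
  rw [← map_mul, ← map_mul] at h
  obtain ⟨p₂, q₂, e, γ, hp, hq⟩ :=
    (SplitsAlong.of_conGen (PresentedMonoid.mk_eq_mk_iff.1 h)).1 p₀ q₀ rfl
  rcases freeMonoid_mul_eq_mul e with ⟨t, rfl, rfl⟩ | ⟨t, rfl, rfl⟩
  · rw [map_mul] at hp
    -- The transported cut lies to the right of `p'`, but its left part has the degree of `p`, at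
    -- most that of `p'`; so only an element of `Γ` lies between them, and it can be inverted.
    have ht : deg φ (PresentedMonoid.mk (Rel φ) t) = 0 := by
      have h1 := congrArg (deg φ) hp
      have h2 : deg φ (ofGroup φ γ) = 0 := rfl
      rw [deg_mul, deg_mul] at h1
      omega
    obtain ⟨δ, hδ⟩ := eq_ofGroup_of_deg_eq_zero _ ht
    rw [hδ] at hp
    refine ⟨ofGroup φ (γ * δ⁻¹), ?_, ?_⟩
    · rw [map_mul, ← mul_assoc, ← hp, mul_assoc, ← map_mul, mul_inv_cancel, map_one, mul_one]
    · rw [map_mul (PresentedMonoid.mk _), hδ, ← mul_assoc, ← map_mul, inv_mul_cancel_right, hq]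
  · refine ⟨ofGroup φ γ * PresentedMonoid.mk (Rel φ) t, ?_, ?_⟩
    · rw [map_mul, hp, mul_assoc]
    · rw [hq, map_mul, mul_assoc]

end Words

/-! ### Monomial orders -/

section Order

variable {X : Type*} {r : FreeMonoid X → FreeMonoid X → Prop}

theorem IsMonomialOrder.irrefl (hr : IsMonomialOrder r) (p : FreeMonoid X) : ¬ r p p :=
  have := hr.isWellOrder
  irrefl_of r p

theorem IsMonomialOrder.trans (hr : IsMonomialOrder r) {p q t : FreeMonoid X} (h₁ : r p q)
    (h₂ : r q t) : r p t :=
  have := hr.isWellOrder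
  trans_of r h₁ h₂

theorem IsMonomialOrder.wellFounded (hr : IsMonomialOrder r) : WellFounded r :=
  hr.isWellOrder.wf

theorem IsMonomialOrder.lt_of_not_lt_of_ne (hr : IsMonomialOrder r) {p q : FreeMonoid X}
    (h : ¬ r p q) (hne : p ≠ q) : r q p :=
  have := hr.isWellOrder
  (trichotomous_of r p q).resolve_left h |>.resolve_left hne

theorem IsMonomialOrder.exists_maximal (hr : IsMonomialOrder r) {ι : Type*} (p : ι → FreeMonoid X)
    {s : Finset ι} (hs : s.Nonempty) : ∃ i ∈ s, ∀ j ∈ s, ¬ r (p i) (p j) := by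
  induction hs using Finset.Nonempty.cons_induction with
  | singleton a => exact ⟨a, by simp, by simpa using hr.irrefl (p a)⟩
  | cons a s ha hs ih =>
    obtain ⟨i, hi, hmax⟩ := ih
    by_cases h : r (p i) (p a)
    · refine ⟨a, by simp, fun j hj => ?_⟩
      rcases Finset.mem_cons.1 hj with rfl | hj
      · exact hr.irrefl _
      · exact fun hj' => hmax j hj (hr.trans h hj')
    · refine ⟨i, by simp [hi], fun j hj => ?_⟩
      rcases Finset.mem_cons.1 hj with rfl | hj
      · exact h
      · exact hmax j hj

end Order

/-! ### Leading monomials and lower terms -/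

section Leading

variable {k : Type*} [Field k] {X Γ : Type*} [Group Γ] {P Q : X → Subgroup Γ}
  {φ : ∀ x, P x ≃* Q x} {r : FreeMonoid X → FreeMonoid X → Prop}

theorem mono_mul (u v : Word φ) : mono k (u * v) = mono k u * mono k v := map_mul _ _ _

theorem coeff_mono [DecidableEq (Word φ)] (u v : Word φ) :
    (mono k u).coeff v = if u = v then 1 else 0 :=
  Finsupp.single_apply

theorem span_range_mono : Submodule.span k (Set.range (mono k : Word φ → Alg k φ)) = ⊤ := by
  refine eq_top_iff.2 fun f _ => ?_
  exact Submodule.span_mono (Set.image_subset_range _ _) (MonoidAlgebra.mem_span_support_coeff f)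

/-- The span of the `Γ`-words `v` with `[v] < p`. -/
noncomputable def low (k : Type*) [Field k] (φ : ∀ x, P x ≃* Q x) (r : FreeMonoid X → FreeMonoid X → Prop)
    (p : FreeMonoid X) : Submodule k (Alg k φ) :=
  Submodule.span k (mono k '' {v | r (proj φ v) p})

theorem mem_low_of_forall {p : FreeMonoid X} {f : Alg k φ}
    (h : ∀ v ∈ f.coeff.support, r (proj φ v) p) : f ∈ low k φ r p :=
  Submodule.span_mono (Set.image_mono h) (MonoidAlgebra.mem_span_support_coeff f)

theorem coeff_eq_zero_of_mem_low {p : FreeMonoid X} {f : Alg k φ} (hf : f ∈ low k φ r p)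
    {v : Word φ} (hv : ¬ r (proj φ v) p) : f.coeff v = 0 := by
  classical
  induction hf using Submodule.span_induction with
  | mem x hx =>
    obtain ⟨u, hu, rfl⟩ := hx
    rw [coeff_mono, if_neg]
    rintro rfl
    exact hv hu
  | zero => simp
  | add x y _ _ hx hy => simp [hx, hy]
  | smul c x _ hx => simp [hx]

theorem mul_mem_low (hr : IsMonomialOrder r) {p : FreeMonoid X} {f : Alg k φ}
    (hf : f ∈ low k φ r p) (a b : Word φ) :
    mono k a * f * mono k b ∈ low k φ r (proj φ a * p * proj φ b) := by
  induction hf using Submodule.span_induction with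
  | mem x hx =>
    obtain ⟨u, hu, rfl⟩ := hx
    rw [← mono_mul, ← mono_mul]
    refine Submodule.subset_span ⟨_, ?_, rfl⟩
    simpa using hr.mul_lt_mul _ _ (proj φ a) (proj φ b) hu
  | zero => simp
  | add x y _ _ hx hy => simpa [mul_add, add_mul] using add_mem hx hy
  | smul c x _ hx => simpa using Submodule.smul_mem _ c hx

theorem coeff_eq_one_of_sub_mem_low (hr : IsMonomialOrder r) {f : Alg k φ} {u : Word φ}
    (hf : f - mono k u ∈ low k φ r (proj φ u)) : f.coeff u = 1 := by
  classical
  have h := coeff_eq_zero_of_mem_low hf (hr.irrefl _)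
  rw [MonoidAlgebra.coeff_sub, Finsupp.sub_apply, coeff_mono, if_pos rfl, sub_eq_zero] at h
  exact h

theorem coeff_eq_zero_of_sub_mem_low {f : Alg k φ} {u v : Word φ}
    (hf : f - mono k u ∈ low k φ r (proj φ u)) (hne : u ≠ v) (hv : ¬ r (proj φ v) (proj φ u)) :
    f.coeff v = 0 := by
  classical
  have h := coeff_eq_zero_of_mem_low hf hv
  rw [MonoidAlgebra.coeff_sub, Finsupp.sub_apply, coeff_mono, if_neg hne, sub_zero] at h
  exact h

theorem IsLeading.coeff_ne_zero {f : Alg k φ} {u : Word φ} (h : IsLeading r f u) :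
    f.coeff u ≠ 0 :=
  Finsupp.mem_support_iff.1 h.1

theorem coeff_smul_normalize {f : Alg k φ} {u : Word φ} (h : IsLeading r f u) :
    f.coeff u • normalize f u = f := by
  rw [normalize, smul_inv_smul₀ h.coeff_ne_zero]

theorem exists_isLeading (hr : IsMonomialOrder r) {f : Alg k φ} (hf : f ≠ 0) :
    ∃ u, IsLeading r f u := by
  refine hr.exists_maximal (proj φ) (Finsupp.support_nonempty_iff.2 ?_)
  rwa [Ne, MonoidAlgebra.coeff_eq_zero]

/-- Maximality depends only on the projection, so a second word of `f` with projection `[u]` would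
also be leading; strongness excludes it. -/
theorem IsStrong.normalize_sub_mono_mem_low (hr : IsMonomialOrder r) {f : Alg k φ}
    (hf : IsStrong r f) {u : Word φ} (hu : IsLeading r f u) :
    normalize f u - mono k u ∈ low k φ r (proj φ u) := by
  classical
  refine mem_low_of_forall fun v hv => ?_
  rw [Finsupp.mem_support_iff, MonoidAlgebra.coeff_sub, Finsupp.sub_apply, coeff_mono, normalize,
    MonoidAlgebra.coeff_smul_apply, smul_eq_mul] at hv
  by_cases huv : u = v
  · subst huv
    rw [if_pos rfl, inv_mul_cancel₀ hu.coeff_ne_zero, sub_self] at hv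
    exact absurd rfl hv
  rw [if_neg huv, sub_zero] at hv
  have hv' : v ∈ f.coeff.support := Finsupp.mem_support_iff.2 (right_ne_zero_of_mul hv)
  refine hr.lt_of_not_lt_of_ne (hu.2 v hv') fun h => huv (hf.unique hu ⟨hv', ?_⟩)
  rw [← h]
  exact hu.2

end Leading

/-! ### Comparing two occurrences of leading monomials -/

section Trivial

variable {k : Type*} [Field k] {X Γ : Type*} [Group Γ] {P Q : X → Subgroup Γ}
  {φ : ∀ x, P x ≃* Q x} {r : FreeMonoid X → FreeMonoid X → Prop} {S : Set (Alg k φ)}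

/-- The span of the elements `a s b` with `s ∈ S` and `[a s̄ b] < p`. -/
noncomputable def trivialSpan (r : FreeMonoid X → FreeMonoid X → Prop) (S : Set (Alg k φ)) (p : FreeMonoid X) :
    Submodule k (Alg k φ) :=
  Submodule.span k {q : Alg k φ | ∃ s ∈ S, ∃ u a b : Word φ, IsLeading r s u ∧
    r (proj φ (a * u * b)) p ∧ q = mono k a * s * mono k b}

theorem isTrivialMod_iff {h : Alg k φ} {w : Word φ} :
    IsTrivialMod r S h w ↔ h ∈ trivialSpan r S (proj φ w) := Iff.rfl

theorem normalize_mem_trivialSpan {s : Alg k φ} (hs : s ∈ S) {u : Word φ} (hu : IsLeading r s u)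
    {p : FreeMonoid X} (a b : Word φ) (h : r (proj φ (a * u * b)) p) :
    mono k a * normalize s u * mono k b ∈ trivialSpan r S p := by
  rw [normalize, mul_smul_comm, smul_mul_assoc]
  exact Submodule.smul_mem _ _ (Submodule.subset_span ⟨s, hs, u, a, b, hu, h, rfl⟩)

theorem mul_mem_trivialSpan (hr : IsMonomialOrder r) {p : FreeMonoid X} {f : Alg k φ}
    (hf : f ∈ trivialSpan r S p) (a b : Word φ) :
    mono k a * f * mono k b ∈ trivialSpan r S (proj φ a * p * proj φ b) := by
  induction hf using Submodule.span_induction with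
  | mem x hx =>
    obtain ⟨s, hs, u, c, d, hu, h, rfl⟩ := hx
    refine Submodule.subset_span ⟨s, hs, u, a * c, d * b, hu, ?_, ?_⟩
    · simpa [mul_assoc] using hr.mul_lt_mul _ _ (proj φ a) (proj φ b) h
    · simp only [mono_mul, mul_assoc]
  | zero => simp
  | add x y _ _ hx hy => simpa [mul_add, add_mul] using add_mem hx hy
  | smul c x _ hx => simpa using Submodule.smul_mem _ c hx

/-- Meant for `f` the tail of another element of `S`; its words are absorbed into the right cofactor
of `s`. -/
theorem normalize_mul_low_mem_trivialSpan (hr : IsMonomialOrder r) {s : Alg k φ} (hs : s ∈ S)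
    {u : Word φ} (hu : IsLeading r s u) {p : FreeMonoid X} {f : Alg k φ} (hf : f ∈ low k φ r p)
    (a c b : Word φ) : mono k a * normalize s u * mono k c * f * mono k b ∈
      trivialSpan r S (proj φ (a * u * c) * p * proj φ b) := by
  induction hf using Submodule.span_induction with
  | mem x hx =>
    obtain ⟨v, hv, rfl⟩ := hx
    have h := normalize_mem_trivialSpan (p := proj φ (a * u * c) * p * proj φ b) hs hu a
      (c * v * b) (by
        simpa [mul_assoc] using hr.mul_lt_mul _ _ (proj φ (a * u * c)) (proj φ b) hv)
    simpa only [mono_mul, mul_assoc] using h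
  | zero => simp
  | add x y _ _ hx hy => simpa [mul_add, add_mul] using add_mem hx hy
  | smul c x _ hx => simpa using Submodule.smul_mem _ c hx

theorem low_mul_normalize_mem_trivialSpan (hr : IsMonomialOrder r) {s : Alg k φ} (hs : s ∈ S)
    {u : Word φ} (hu : IsLeading r s u) {p : FreeMonoid X} {f : Alg k φ} (hf : f ∈ low k φ r p)
    (a c b : Word φ) : mono k a * f * mono k c * normalize s u * mono k b ∈
      trivialSpan r S (proj φ a * p * proj φ (c * u * b)) := by
  induction hf using Submodule.span_induction with
  | mem x hx =>
    obtain ⟨v, hv, rfl⟩ := hx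
    have h := normalize_mem_trivialSpan (p := proj φ a * p * proj φ (c * u * b)) hs hu
      (a * v * c) b (by
        simpa [mul_assoc] using hr.mul_lt_mul _ _ (proj φ a) (proj φ (c * u * b)) hv)
    simpa only [mono_mul, mul_assoc] using h
  | zero => simp
  | add x y _ _ hx hy => simpa [mul_add, add_mul] using add_mem hx hy
  | smul c x _ hx => simpa using Submodule.smul_mem _ c hx

/-- Two elements `a s b` with disjoint occurrences of their leading monomials in the same `Γ`-word
agree up to smaller terms. -/
theorem sub_mem_trivialSpan_of_disjoint (hr : IsMonomialOrder r) (hS : IsStrongGSBasis r S)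
    {s t : Alg k φ} (hs : s ∈ S) (ht : t ∈ S) {u v : Word φ} (hu : IsLeading r s u)
    (hv : IsLeading r t v) (a c b : Word φ) :
    mono k a * normalize s u * mono k (c * v * b) - mono k (a * u * c) * normalize t v * mono k b
      ∈ trivialSpan r S (proj φ (a * u * c * v * b)) := by
  have h₁ := normalize_mul_low_mem_trivialSpan hr hs hu
    ((hS.strong t ht).normalize_sub_mono_mem_low hr hv) a c b
  have h₂ := low_mul_normalize_mem_trivialSpan hr ht hv
    ((hS.strong s hs).normalize_sub_mono_mem_low hr hu) a c b
  have e : proj φ a * proj φ u * proj φ (c * v * b) = proj φ (a * u * c * v * b) := by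
    simp [mul_assoc]
  rw [e] at h₂
  rw [← map_mul, ← map_mul] at h₁
  -- With `s`, `t` monic: `a s c v b - a u c t b = a (s - u) c t b - a s c (t - v) b`.
  convert sub_mem h₂ h₁ using 1
  simp only [mono_mul]
  noncomm_ring

/-- Equidivisibility gives `a' = a c` and `u b = c v b'`. Comparing `deg u` with `deg c` and `deg (c
v)` leaves a disjoint pair, an inclusion or an intersection. Here `c` may have degree zero, hence
the compositions with cofactors in `Γ`. -/
theorem sub_mem_trivialSpan_of_deg_le (hr : IsMonomialOrder r) (hS : IsStrongGSBasis r S)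
    {s t : Alg k φ} (hs : s ∈ S) (ht : t ∈ S) {u v : Word φ} (hu : IsLeading r s u)
    (hv : IsLeading r t v) {a b a' b' : Word φ} (h : a * u * b = a' * v * b')
    (hd : deg φ a ≤ deg φ a') :
    mono k a * normalize s u * mono k b - mono k a' * normalize t v * mono k b'
      ∈ trivialSpan r S (proj φ (a * u * b)) := by
  obtain ⟨c, rfl, hc⟩ := exists_eq_mul_of_mul_eq_mul (p := a) (q := u * b) (p' := a')
    (q' := v * b') (by simpa only [mul_assoc] using h) hd
  rcases le_or_gt (deg φ u) (deg φ c) with huc | huc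
  · obtain ⟨e, rfl, rfl⟩ := exists_eq_mul_of_mul_eq_mul hc huc
    have := sub_mem_trivialSpan_of_disjoint hr hS hs ht hu hv a e b'
    simpa only [mul_assoc] using this
  rw [← mul_assoc] at hc
  rcases le_or_gt (deg φ (c * v)) (deg φ u) with hcv | hcv
  · obtain ⟨d, rfl, rfl⟩ := exists_eq_mul_of_mul_eq_mul hc.symm hcv
    have := hS.trivial s hs t ht _ _ (IsComposition.inclusion _ v c d hu hv rfl)
    have := mul_mem_trivialSpan hr (isTrivialMod_iff.1 this) a b
    rw [← map_mul, ← map_mul] at this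
    convert this using 1
    simp only [mono_mul, mul_sub, sub_mul, mul_assoc]
  · obtain ⟨d, hd', rfl⟩ := exists_eq_mul_of_mul_eq_mul hc hcv.le
    -- The overlap is proper because `deg c < deg u`.
    have hdeg : deg φ (u * d) < deg φ u + deg φ v := by
      rw [← hd', deg_mul]
      omega
    have := hS.trivial s hs t ht _ _ (IsComposition.intersection u v c d hu hv hd'.symm hdeg)
    have := mul_mem_trivialSpan hr (isTrivialMod_iff.1 this) a b'
    rw [← map_mul, ← map_mul] at this
    convert this using 1
    · simp only [mul_assoc]
    · simp only [mono_mul, mul_sub, sub_mul, mul_assoc]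

theorem sub_mem_trivialSpan (hr : IsMonomialOrder r) (hS : IsStrongGSBasis r S)
    {s t : Alg k φ} (hs : s ∈ S) (ht : t ∈ S) {u v : Word φ} (hu : IsLeading r s u)
    (hv : IsLeading r t v) {a b a' b' : Word φ} (h : a * u * b = a' * v * b') :
    mono k a * normalize s u * mono k b - mono k a' * normalize t v * mono k b'
      ∈ trivialSpan r S (proj φ (a * u * b)) := by
  rcases le_total (deg φ a) (deg φ a') with hd | hd
  · exact sub_mem_trivialSpan_of_deg_le hr hS hs ht hu hv h hd
  · rw [← neg_sub, h]
    exact neg_mem (sub_mem_trivialSpan_of_deg_le hr hS ht hs hv hu h.symm hd)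

end Trivial

/-! ### Spanning the ideal, and the basis of the quotient -/

section Reduction

variable {k : Type*} [Field k] {X Γ : Type*} [Group Γ] {P Q : X → Subgroup Γ}
  {φ : ∀ x, P x ≃* Q x} {r : FreeMonoid X → FreeMonoid X → Prop} {S : Set (Alg k φ)}

/-- The words span the algebra, so this span is closed under multiplication on both sides. -/
theorem mem_span_of_mem_Id {f : Alg k φ} (hf : f ∈ Id S) :
    f ∈ Submodule.span k {q : Alg k φ | ∃ s ∈ S, ∃ a b : Word φ, q = mono k a * s * mono k b} := by
  set N := Submodule.span k
    {q : Alg k φ | ∃ s ∈ S, ∃ a b : Word φ, q = mono k a * s * mono k b} with hN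
  have hl : ∀ (x : Alg k φ) {y}, y ∈ N → x * y ∈ N := by
    intro x y hy
    have hx : x ∈ Submodule.span k (Set.range (mono k : Word φ → Alg k φ)) :=
      span_range_mono.ge Submodule.mem_top
    have := Submodule.mul_mem_mul hx hy
    rw [hN, Submodule.span_mul_span] at this
    refine Submodule.span_mono ?_ this
    rintro _ ⟨_, ⟨c, rfl⟩, _, ⟨s, hs, a, b, rfl⟩, rfl⟩
    exact ⟨s, hs, c * a, b, by simp only [mono_mul, mul_assoc]⟩
  have hrt : ∀ {x : Alg k φ} (y), x ∈ N → x * y ∈ N := by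
    intro x y hx
    have hy : y ∈ Submodule.span k (Set.range (mono k : Word φ → Alg k φ)) :=
      span_range_mono.ge Submodule.mem_top
    have := Submodule.mul_mem_mul hx hy
    rw [hN, Submodule.span_mul_span] at this
    refine Submodule.span_mono ?_ this
    rintro _ ⟨_, ⟨s, hs, a, b, rfl⟩, _, ⟨c, rfl⟩, rfl⟩
    exact ⟨s, hs, a, b * c, by simp only [mono_mul, mul_assoc]⟩
  have hle : Id S ≤ TwoSidedIdeal.mk' (N : Set (Alg k φ)) N.zero_mem N.add_mem N.neg_mem
      (fun {x _} hy => hl x hy) (fun {_ y} hx => hrt y hx) := by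
    refine TwoSidedIdeal.span_le.2 fun s hs => ?_
    rw [TwoSidedIdeal.coe_mk']
    exact Submodule.subset_span ⟨s, hs, 1, 1, by simp only [mono, map_one, one_mul, mul_one]⟩
  have := hle hf
  rwa [TwoSidedIdeal.mem_mk'] at this

theorem mul_mem_Id {s : Alg k φ} (hs : s ∈ S) (x y : Alg k φ) : x * s * y ∈ Id S :=
  TwoSidedIdeal.mul_mem_right _ _ _ (TwoSidedIdeal.mul_mem_left _ _ _
    (TwoSidedIdeal.subset_span hs))

/-- The `Γ`-words of the form `a s̄ b` with `s ∈ S`. -/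
def Reducible (r : FreeMonoid X → FreeMonoid X → Prop) (S : Set (Alg k φ)) (w : Word φ) : Prop :=
  ∃ s ∈ S, ∃ u, IsLeading r s u ∧ ∃ a b : Word φ, w = a * u * b

theorem mem_Irr_iff {w : Word φ} : w ∈ Irr r S ↔ ¬ Reducible r S w := by
  constructor
  · rintro h ⟨s, hs, u, hu, a, b, e⟩
    exact h s hs u a b hu e
  · intro h s hs u a b hu e
    exact h ⟨s, hs, u, hu, a, b, e⟩

/-- A choice, for every reducible `Γ`-word `w`, of an element `e w` of the ideal with leading
monomial `w`; these elements span the ideal. -/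
theorem exists_reductors (hr : IsMonomialOrder r) (hS : IsStrongGSBasis r S) :
    ∃ e : Word φ → Alg k φ, (∀ w, Reducible r S w →
      e w ∈ Id S ∧ e w - mono k w ∈ low k φ r (proj φ w)) ∧
      ∀ f ∈ Id S, f ∈ Submodule.span k (e '' {w | Reducible r S w}) := by
  have key : ∀ w : Word φ, ∃ e : Alg k φ, Reducible r S w →
      e ∈ Id S ∧ e - mono k w ∈ low k φ r (proj φ w) ∧
      ∀ s ∈ S, ∀ u a b : Word φ, IsLeading r s u → w = a * u * b →
        mono k a * normalize s u * mono k b - e ∈ trivialSpan r S (proj φ w) := by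
    intro w
    by_cases hw : Reducible r S w
    · obtain ⟨t, ht, v, hv, a', b', rfl⟩ := hw
      refine ⟨mono k a' * normalize t v * mono k b', fun _ => ⟨?_, ?_, ?_⟩⟩
      · rw [normalize, mul_smul_comm, ← smul_mul_assoc]
        exact mul_mem_Id ht _ _
      · have := mul_mem_low hr ((hS.strong t ht).normalize_sub_mono_mem_low hr hv) a' b'
        rwa [mul_sub, sub_mul, ← mono_mul, ← mono_mul, ← map_mul, ← map_mul] at this
      · intro s hs u a b hu h
        rw [h]
        exact sub_mem_trivialSpan hr hS hs ht hu hv h.symm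
    -- A dummy value at irreducible words.
    · exact ⟨0, fun h => absurd h hw⟩
  choose e he using key
  refine ⟨e, fun w hw => ⟨(he w hw).1, (he w hw).2.1⟩, fun f hf => ?_⟩
  -- Induction on `[a s̄ b]`: up to a scalar, `a s b` is `e (a s̄ b)` plus terms `c t d` with
  -- smaller `[c t̄ d]`.
  have main : ∀ p : FreeMonoid X, ∀ s ∈ S, ∀ u a b : Word φ, IsLeading r s u →
      proj φ (a * u * b) = p →
      mono k a * s * mono k b ∈ Submodule.span k (e '' {w | Reducible r S w}) := by
    intro p
    induction p using hr.wellFounded.induction with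
    | _ p ih =>
      intro s hs u a b hu hp
      have hw : Reducible r S (a * u * b) := ⟨s, hs, u, hu, a, b, rfl⟩
      have h₁ := (he _ hw).2.2 s hs u a b hu rfl
      have h₂ : trivialSpan r S (proj φ (a * u * b)) ≤
          Submodule.span k (e '' {w | Reducible r S w}) := by
        refine Submodule.span_le.2 ?_
        rintro _ ⟨t, ht, v, c, d, hv, hlt, rfl⟩
        exact ih _ (hp ▸ hlt) t ht v c d hv rfl
      have h₃ := add_mem (h₂ h₁) (Submodule.subset_span ⟨_, hw, rfl⟩)
      rw [sub_add_cancel] at h₃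
      have h₄ := Submodule.smul_mem _ (s.coeff u) h₃
      rwa [← smul_mul_assoc, ← mul_smul_comm, coeff_smul_normalize hu] at h₄
  refine Submodule.span_le.2 ?_ (mem_span_of_mem_Id hf)
  rintro _ ⟨s, hs, a, b, rfl⟩
  obtain ⟨u, hu, -⟩ := hS.strong s hs
  exact main _ s hs u a b hu rfl

/-- Unitriangularity: for an index `v ≠ w`, the word `w` is neither `v` nor below it, so it does not
occur in `e v`. The word `w` itself need not be an index. -/
theorem coeff_linearCombination_of_maximal (hr : IsMonomialOrder r) {e : Word φ → Alg k φ}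
    {c : Word φ →₀ k} (he : ∀ v ∈ c.support, e v - mono k v ∈ low k φ r (proj φ v)) {w : Word φ}
    (hw : ∀ v ∈ c.support, ¬ r (proj φ w) (proj φ v)) :
    (Finsupp.linearCombination k e c).coeff w = c w := by
  rw [Finsupp.linearCombination_apply, Finsupp.sum, MonoidAlgebra.coeff_sum,
    Finsupp.finsetSum_apply, Finset.sum_eq_single w]
  · by_cases h : w ∈ c.support
    · rw [MonoidAlgebra.coeff_smul_apply, coeff_eq_one_of_sub_mem_low hr (he w h), smul_eq_mul,
        mul_one]
    · rw [Finsupp.notMem_support_iff.1 h, zero_smul, MonoidAlgebra.coeff_zero, Finsupp.zero_apply]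
  · intro v hv hne
    rw [MonoidAlgebra.coeff_smul_apply, coeff_eq_zero_of_sub_mem_low (he v hv) hne (hw v hv),
      smul_zero]
  · intro h
    rw [Finsupp.notMem_support_iff.1 h, zero_smul, MonoidAlgebra.coeff_zero, Finsupp.zero_apply]

theorem reducible_of_isLeading (hr : IsMonomialOrder r) (hS : IsStrongGSBasis r S) {f : Alg k φ}
    (hf : f ∈ Id S) {w : Word φ} (hw : IsLeading r f w) : Reducible r S w := by
  obtain ⟨e, he, hspan⟩ := exists_reductors hr hS
  obtain ⟨c, hc, rfl⟩ := (Finsupp.mem_span_image_iff_linearCombination k).1 (hspan f hf)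
  have hc' : ∀ v ∈ c.support, Reducible r S v := fun v hv => hc hv
  have he' : ∀ v ∈ c.support, e v - mono k v ∈ low k φ r (proj φ v) :=
    fun v hv => (he v (hc' v hv)).2
  have hne : c.support.Nonempty := by
    refine Finsupp.support_nonempty_iff.2 ?_
    rintro rfl
    exact hw.coeff_ne_zero (by simp)
  -- A maximal index `v` occurs in `f`, so the leading `w` is not below it; hence `w` is below no
  -- index, and its coefficient in `f` is `c w`.
  obtain ⟨v, hv, hmax⟩ := hr.exists_maximal (proj φ) hne
  have hwv : ¬ r (proj φ w) (proj φ v) := by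
    refine hw.2 v (Finsupp.mem_support_iff.2 ?_)
    rw [coeff_linearCombination_of_maximal hr he' hmax]
    exact Finsupp.mem_support_iff.1 hv
  have hwmax : ∀ v' ∈ c.support, ¬ r (proj φ w) (proj φ v') := by
    intro v' hv' h
    by_cases hEq : proj φ w = proj φ v
    · exact hmax v' hv' (hEq ▸ h)
    · exact hmax v' hv' (hr.trans (hr.lt_of_not_lt_of_ne hwv hEq) h)
  have hcw := coeff_linearCombination_of_maximal hr he' hwmax
  exact hc' w (Finsupp.mem_support_iff.2 (hcw ▸ hw.coeff_ne_zero))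

theorem mkₐ_eq_zero_iff {f : Alg k φ} : RingCon.mkₐ k (Id S).ringCon f = 0 ↔ f ∈ Id S := by
  rw [TwoSidedIdeal.mem_iff]
  exact RingCon.eq (Id S).ringCon

/-- A nonzero combination of irreducible words lying in the ideal would have a leading monomial both
irreducible and reducible. -/
theorem linearIndependent_Irr (hr : IsMonomialOrder r) (hS : IsStrongGSBasis r S) :
    LinearIndependent k fun u : Irr r S =>
      RingCon.mkₐ k (Id S).ringCon (mono k (u : Word φ)) := by
  classical
  rw [linearIndependent_iff]
  intro c hc
  have hcoeff : ∀ v : Word φ, (Finsupp.linearCombination k (fun u : Irr r S => mono k u.1) c).coeff v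
      = if h : v ∈ Irr r S then c ⟨v, h⟩ else 0 := by
    intro v
    rw [Finsupp.linearCombination_apply, Finsupp.sum, MonoidAlgebra.coeff_sum,
      Finsupp.finsetSum_apply]
    simp only [MonoidAlgebra.coeff_smul_apply, coeff_mono, smul_eq_mul, mul_ite, mul_one, mul_zero]
    split_ifs with h
    · rw [Finset.sum_eq_single ⟨v, h⟩]
      · simp
      · intro u _ hu
        exact if_neg fun e => hu (Subtype.ext e)
      · simp
    · refine Finset.sum_eq_zero fun u _ => if_neg ?_
      rintro rfl
      exact h u.2
  have hmem : Finsupp.linearCombination k (fun u : Irr r S => mono k u.1) c ∈ Id S := by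
    rw [← mkₐ_eq_zero_iff, ← hc]
    simp [Finsupp.linearCombination_apply, Finsupp.sum, map_sum]
  have hzero : Finsupp.linearCombination k (fun u : Irr r S => mono k u.1) c = 0 := by
    by_contra hne
    obtain ⟨w, hw⟩ := exists_isLeading hr hne
    have := hw.coeff_ne_zero
    rw [hcoeff, dif_neg fun h => mem_Irr_iff.1 h (reducible_of_isLeading hr hS hmem hw)] at this
    exact this rfl
  ext u
  have := hcoeff u
  rw [hzero, dif_pos u.2] at this
  simpa using this.symm

/-- Modulo the ideal a reducible `w` equals `w - e w`, a combination of words of smaller projection;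
induct on `[w]`. -/
theorem span_Irr_eq_top (hr : IsMonomialOrder r) (hS : IsStrongGSBasis r S) :
    Submodule.span k (Set.range fun u : Irr r S =>
      RingCon.mkₐ k (Id S).ringCon (mono k (u : Word φ))) = ⊤ := by
  obtain ⟨e, he, -⟩ := exists_reductors hr hS
  set N := Submodule.span k (Set.range fun u : Irr r S =>
      RingCon.mkₐ k (Id S).ringCon (mono k (u : Word φ)))
  set π : Alg k φ →ₗ[k] QuotAlg S := (RingCon.mkₐ k (Id S).ringCon).toLinearMap
  have main : ∀ p : FreeMonoid X, ∀ w : Word φ, proj φ w = p → π (mono k w) ∈ N := by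
    intro p
    induction p using hr.wellFounded.induction with
    | _ p ih =>
      intro w hp
      by_cases hw : w ∈ Irr r S
      · exact Submodule.subset_span ⟨⟨w, hw⟩, rfl⟩
      · obtain ⟨hmem, hlow⟩ := he w (not_not.1 (mem_Irr_iff.not.1 hw))
        have hle : low k φ r (proj φ w) ≤ N.comap π := by
          refine Submodule.span_le.2 ?_
          rintro _ ⟨v, hv, rfl⟩
          exact ih _ (hp ▸ hv) v rfl
        have h : π (e w - mono k w) ∈ N := hle hlow
        have h0 : π (e w) = 0 := mkₐ_eq_zero_iff.2 hmem
        rw [map_sub, h0, zero_sub] at h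
        exact neg_mem_iff.1 h
  refine eq_top_iff.2 fun y _ => ?_
  obtain ⟨f, rfl⟩ := RingCon.mkₐ_surjective (α := k) (Id S).ringCon y
  have hle : Submodule.span k (Set.range (mono k : Word φ → Alg k φ)) ≤ N.comap π := by
    refine Submodule.span_le.2 ?_
    rintro _ ⟨w, rfl⟩
    exact main _ w rfl
  exact hle (span_range_mono.ge Submodule.mem_top)

end Reduction

end FreeGamma

theorem mainTheorem4 {k : Type*} [Field k] {X Γ : Type*} [Group Γ] {P Q : X → Subgroup Γ}
    (φ : ∀ x, P x ≃* Q x) (r : FreeMonoid X → FreeMonoid X → Prop)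
    (hr : FreeGamma.IsMonomialOrder r) (S : Set (FreeGamma.Alg k φ))
    (hS : FreeGamma.IsStrongGSBasis r S) :
    (∀ f ∈ FreeGamma.Id S, f ≠ 0 →
      (∃ w, FreeGamma.IsLeading r f w) ∧
      ∀ w, FreeGamma.IsLeading r f w →
        ∃ s ∈ S, ∃ u, FreeGamma.IsLeading r s u ∧ ∃ a b : FreeGamma.Word φ, w = a * u * b) ∧
    ∃ B : Module.Basis (FreeGamma.Irr r S) k (FreeGamma.QuotAlg S),
      ∀ u : FreeGamma.Irr r S,
        B u = RingCon.mkₐ k (FreeGamma.Id S).ringCon (FreeGamma.mono k (u : FreeGamma.Word φ)) :=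
  ⟨fun _ hf hne => ⟨FreeGamma.exists_isLeading hr hne,
      fun _ hw => FreeGamma.reducible_of_isLeading hr hS hf hw⟩,
    Module.Basis.mk (FreeGamma.linearIndependent_Irr hr hS)
      (FreeGamma.span_Irr_eq_top hr hS).ge,
    fun u => Module.Basis.mk_apply _ _ u⟩
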